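/- Let $T$ be a commutative Noetherian ring, $f\in T$ a nonzerodivisor, $R=T/(f)$, and let $I$ be an ideal of $T$ containing $f$. Fix a finite sequence of generators $\mathbf v=(f,f_1,\dots,f_n)$ of $I$ ($n\ge 0$). A finitely generated $R$-module $L$ is called liftable to $T$ if there is a finitely generated $T$-module $M'$ with $M'\otimes_T R\cong L$ and $\operatorname{Tor}_i^T(M',R)=0$ for all $i>0$; an $R$-module is weakly liftable to $T$ if it is a direct summand of a liftable $R$-module. A linear map splits if it has a linear left inverse. The following are equivalent: (1) $T/I$, as an $R$-module, is weakly liftable to $T$. (2) The $T$-linear map $h:T/I\to I/fI$, $1+I\mapsto f+fI$, splits. (3) The $T$-linear map $g:T/I\to I/I^2$, $1+I\mapsto f+I^2$, splits. (4) For every presentation $T^m\xrightarrow{X}T^{n+1}\xrightarrow{\mathbf v}I\to 0$, with $\mathbf r,\mathbf r_1,\dots,\mathbf r_n$ the rows of $X$, there exist $x_1,\dots,x_n\in T$ such that $\mathbf r-(x_1\mathbf r_1+\dots+x_n\mathbf r_n)\in I\,T^m$. (4′) For some such presentation, there exist $x_1,\dots,x_n\in T$ as in (4). They imply the following condition (5);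 moreover (5) and (6) are equivalent, and if $T$ is local then (5), (6) and (7) are equivalent: (5) $(IJ:f)\subseteq J+I$ for every ideal $J$ of $T$. (6) $(IJ:f)\subseteq J$ for every ideal $J\supseteq I$ of $T$. (7) $(IJ:f)\subseteq J$ for every irreducible ideal $J\supseteq I$ of $T$ (an ideal is irreducible if it is proper and is not the intersection of two strictly larger ideals). If in addition $T/I$ is approximately Gorenstein, then all the conditions (1)–(6), and also (7) if $T$ is local, are equivalent. Here a Noetherian local ring is Gorenstein if it has finite injective dimension as a module over itself; a Noetherian local ring $(A,\mathfrak m)$ is approximately Gorenstein if for every integer $N\ge 0$ there is an ideal $Q\subseteq\mathfrak m^N$ such that $A/Q$ is a Gorenstein local ring; and a Noetherian ring is approximately Gorenstein if its localization at every maximal ideal is. -/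

import Mathlib

open scoped TensorProduct

universe u

namespace WeakLifting

/-- An `R`-module `M` lifts to `T` along `T → R` if there is a finitely generated `T`-module `M'`
with `R ⊗_T M' ≅ M` as `R`-modules and `Tor_i^T(M', R) = 0` for all `i > 0`. -/
def Liftable (T R : Type u) [CommRing T] [CommRing R] [Algebra T R]
    (M : Type u) [AddCommGroup M] [Module R M] : Prop :=
  ∃ (M' : Type u) (_ : AddCommGroup M') (_ : Module T M'),
    Module.Finite T M' ∧
    Nonempty (R ⊗[T] M' ≃ₗ[R] M) ∧
    ∀ i : ℕ, 0 < i → CategoryTheory.Limits.IsZero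
      (((CategoryTheory.Tor (ModuleCat.{u} T) i).obj (ModuleCat.of T M')).obj (ModuleCat.of T R))

/-- An `R`-module `M` weakly lifts to `T` if it is a direct summand of a liftable `R`-module. -/
def WeaklyLiftable (T R : Type u) [CommRing T] [CommRing R] [Algebra T R]
    (M : Type u) [AddCommGroup M] [Module R M] : Prop :=
  ∃ (L : Type u) (_ : AddCommGroup L) (_ : Module R L)
    (N : Type u) (_ : AddCommGroup N) (_ : Module R N),
    Liftable T R L ∧ Nonempty (L ≃ₗ[R] M × N)

/-- For `f ∈ I`, the ring map `T/(f) → T/I`. -/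
def quotMap {T : Type u} [CommRing T] {I : Ideal T} {f : T} (hf : f ∈ I) :
    T ⧸ Ideal.span {f} →+* T ⧸ I :=
  Ideal.Quotient.factor ((Ideal.span_singleton_le_iff_mem I).mpr hf)

/-- For `f ∈ I`, the statement that `T/I`, as a module over `R = T/(f)`, weakly lifts to `T`. -/
def QuotientWeaklyLiftable {T : Type u} [CommRing T] (I : Ideal T) (f : T) (hf : f ∈ I) : Prop :=
  letI : Module (T ⧸ Ideal.span {f}) (T ⧸ I) := Module.compHom (T ⧸ I) (quotMap hf)
  WeaklyLiftable T (T ⧸ Ideal.span {f}) (T ⧸ I)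

/-- The `T`-linear map `T/I → I/fI` with `1 + I ↦ f + fI`. -/
def mapToModF {T : Type u} [CommRing T] (I : Ideal T) (f : T) (hf : f ∈ I) :
    (T ⧸ I) →ₗ[T] (I ⧸ (Ideal.span {f} • ⊤ : Submodule T I)) :=
  Submodule.liftQ I
    (LinearMap.toSpanSingleton T (I ⧸ (Ideal.span {f} • ⊤ : Submodule T I))
      (Submodule.Quotient.mk ⟨f, hf⟩))
    (by
      intro a ha
      rw [LinearMap.mem_ker, LinearMap.toSpanSingleton_apply, ← Submodule.Quotient.mk_smul,
        Submodule.Quotient.mk_eq_zero]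
      have h : a • (⟨f, hf⟩ : I) = f • (⟨a, ha⟩ : I) := by
        ext; simp [mul_comm]
      rw [h]
      exact Submodule.smul_mem_smul (Ideal.mem_span_singleton_self f) trivial)

/-- The `T`-linear map `T/I → I/I²` with `1 + I ↦ f + I²`. -/
def mapToCotangent {T : Type u} [CommRing T] (I : Ideal T) (f : T) (hf : f ∈ I) :
    (T ⧸ I) →ₗ[T] I.Cotangent :=
  Submodule.liftQ I (LinearMap.toSpanSingleton T I.Cotangent (I.toCotangent ⟨f, hf⟩))
    (by
      intro a ha
      rw [LinearMap.mem_ker, LinearMap.toSpanSingleton_apply, ← map_smul, Ideal.toCotangent_eq_zero]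
      have h : ((a • (⟨f, hf⟩ : I) : I) : T) = a * f := rfl
      rw [h, pow_two]
      exact Ideal.mul_mem_mul ha hf)

/-- A `T`-linear map `A → B` splits if it has a `T`-linear left inverse. -/
def Splits {T A B : Type*} [CommRing T] [AddCommGroup A] [Module T A] [AddCommGroup B] [Module T B]
    (h : A →ₗ[T] B) : Prop :=
  ∃ s : B →ₗ[T] A, s ∘ₗ h = LinearMap.id

/-- `T^m --X--> T^k --v--> (v) → 0` is exact: the columns of `X` generate all relations
on the entries of `v`. -/
def IsPresentation {T : Type*} [CommRing T] {k m : ℕ} (v : Fin k → T)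
    (X : Matrix (Fin k) (Fin m) T) : Prop :=
  Function.Exact X.mulVecLin (Fintype.linearCombination T v)

/-- The zeroth row of `X` is, modulo `I T^m`, a `T`-linear combination of the other rows. -/
def RowCondition {T : Type*} [CommRing T] (I : Ideal T) {n m : ℕ}
    (X : Matrix (Fin (n + 1)) (Fin m) T) : Prop :=
  ∃ x : Fin n → T, X 0 - ∑ i : Fin n, x i • X i.succ ∈ (I • ⊤ : Submodule T (Fin m → T))

/-- A Noetherian local ring is Gorenstein if it has finite injective dimension over itself. -/
def IsGorensteinLocal (S : Type u) [CommRing S] : Prop :=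
  IsNoetherianRing S ∧ IsLocalRing S ∧
    ∃ n : ℕ, CategoryTheory.HasInjectiveDimensionLE (ModuleCat.of S S) n

/-- A local ring `(A, m)` is approximately Gorenstein if every power of `m` contains an ideal `Q`
such that `A/Q` is Gorenstein. -/
def IsApproxGorensteinLocal (A : Type u) [CommRing A] [IsLocalRing A] : Prop :=
  ∀ N : ℕ, ∃ Q : Ideal A, Q ≤ IsLocalRing.maximalIdeal A ^ N ∧ IsGorensteinLocal (A ⧸ Q)

/-- A Noetherian ring is approximately Gorenstein if all its localizations at maximal ideals are. -/
def IsApproxGorenstein (A : Type u) [CommRing A] : Prop :=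
  IsNoetherianRing A ∧
    ∀ (p : Ideal A) [p.IsMaximal], IsApproxGorensteinLocal (Localization.AtPrime p)

end WeakLifting

/-! Conditions (1)–(4′) all say that some linear map `φ : I → T/I` has `φ(f) = 1`. As `f` is a
nonzerodivisor, Tor against `T/(f)` vanishes in positive degrees exactly when `f` is regular on the
module (`isZero_tor_quotient_span_singleton_iff`). Given `φ`, the module `I` lifts `I/fI`, of which
`T/I` is a summand. Conversely, if `T/I` is a summand of `M'/fM'` and `m` lifts its generator, then
`im = f·x_i` with `x_i` unique for each `i ∈ I`, and `φ` sends `i` to the component of `x_i` in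
`T/I`. Every map `I → T/I` kills `I²`, which gives (2) and (3); written on generators, `φ` is the
row condition. Applying `φ` to `af ∈ IJ` gives (5).

For the converse, the zeroth row of `X` must lie in the span of the others plus `I T^m`. By Krull's
intersection theorem it is enough to work modulo `p^N` for maximal `p`; only `p ⊇ I` matters. There
one uses a self-injective quotient `B` of `(T/I)_p` with kernel inside the `N`-th power of the
maximal ideal. The colon condition for the kernel of `T → B` says that over `B` a vector killed by
the other rows is killed by the zeroth row; injectivity then makes the zeroth row a combination of
the others (`exists_row_relation`).

Such `B` come from Gorenstein quotients: dividing by a high power of a nonzerodivisor lowers the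
injective dimension by one, and once the maximal ideal has no nonzerodivisor, finite injective
dimension forces self-injectivity. -/

section ShortResolution

/-! ### Two-term projective resolutions and Tor against `T/(f)` -/

open CategoryTheory Limits HomologicalComplex

universe v w

variable {C : Type w} [Category.{v} C] [Abelian C]

lemma exactAt_one_of_isZero_iff_mono (K : ChainComplex C ℕ) (h2 : IsZero (K.X 2)) :
    K.ExactAt 1 ↔ Mono (K.d 1 0) := by
  rw [exactAt_iff' K 2 1 0 (by simp) (by simp)]
  exact ShortComplex.exact_iff_mono _ (h2.eq_of_src _ _)

/-- The chain complex with a single nonzero differential `φ`, from degree `1` to degree `0`. -/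
noncomputable abbrev twoTermComplex {A B : C} (φ : A ⟶ B) : ChainComplex C ℕ :=
  double φ (show (ComplexShape.down ℕ).Rel 1 0 by simp)

lemma isZero_twoTermComplex_X {A B : C} (φ : A ⟶ B) {k : ℕ} (hk : 2 ≤ k) :
    IsZero ((twoTermComplex φ).X k) :=
  isZero_double_X _ _ _ (by omega) (by omega)

noncomputable abbrev twoTermComplexXOneIso {A B : C} (φ : A ⟶ B) : (twoTermComplex φ).X 1 ≅ A :=
  doubleXIso₀ φ _

noncomputable abbrev twoTermComplexXZeroIso {A B : C} (φ : A ⟶ B) : (twoTermComplex φ).X 0 ≅ B :=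
  doubleXIso₁ φ _ one_ne_zero

lemma twoTermComplex_d {A B : C} (φ : A ⟶ B) :
    (twoTermComplex φ).d 1 0 =
      (twoTermComplexXOneIso φ).hom ≫ φ ≫ (twoTermComplexXZeroIso φ).inv :=
  double_d _ _ one_ne_zero

lemma twoTermComplex_hom_comp {A B : C} (φ : A ⟶ B) :
    (twoTermComplexXOneIso φ).hom ≫ φ =
      (twoTermComplex φ).d 1 0 ≫ (twoTermComplexXZeroIso φ).hom := by
  rw [twoTermComplex_d]; simp

lemma twoTermComplex_exactAt_succ {A B : C} (φ : A ⟶ B) [Mono φ] (n : ℕ) :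
    (twoTermComplex φ).ExactAt (n + 1) := by
  match n with
  | 0 =>
    rw [zero_add, exactAt_one_of_isZero_iff_mono _ (isZero_twoTermComplex_X φ le_rfl),
      twoTermComplex_d]
    infer_instance
  | n + 1 => exact ShortComplex.exact_of_isZero_X₂ _ (isZero_twoTermComplex_X φ (by omega))

/-- A short exact sequence whose first two terms are projective is a projective resolution of
its third term. -/
noncomputable def shortProjectiveResolution {S : ShortComplex C} (hS : S.ShortExact)
    [Projective S.X₁] [Projective S.X₂] : ProjectiveResolution S.X₃ where
  complex := twoTermComplex S.f
  projective n := by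
    match n with
    | 0 => exact Projective.of_iso (twoTermComplexXZeroIso S.f).symm inferInstance
    | 1 => exact Projective.of_iso (twoTermComplexXOneIso S.f).symm inferInstance
    | n + 2 =>
      exact Projective.of_iso (isZero_twoTermComplex_X S.f (by omega)).isoZero.symm inferInstance
  π := (ChainComplex.toSingle₀Equiv _ _).symm ⟨(twoTermComplexXZeroIso S.f).hom ≫ S.g, by
    rw [twoTermComplex_d]; simp⟩
  quasiIso := ⟨fun n => by
    have := hS.mono_f
    have := hS.epi_g
    cases n with
    | zero =>
      -- In degree 0 a quasi-isomorphism amounts to exactness at the middle term together with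
      -- surjectivity of the augmentation.
      rw [ChainComplex.quasiIsoAt₀_iff, ShortComplex.quasiIso_iff_of_zeros']
      · refine (ShortComplex.exact_and_epi_g_iff_of_iso (S₂ := S) ?_).2 ⟨hS.exact, hS.epi_g⟩
        refine ShortComplex.isoMk (twoTermComplexXOneIso S.f) (twoTermComplexXZeroIso S.f)
          (Iso.refl _) ?_ ?_
        · exact twoTermComplex_hom_comp S.f
        · refine Eq.trans ?_ (Category.comp_id _).symm
          exact (ChainComplex.toSingle₀Equiv_symm_apply_f_zero
            ((twoTermComplexXZeroIso S.f).hom ≫ S.g) (by rw [twoTermComplex_d]; simp)).symm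
      · exact (twoTermComplex S.f).shape 0 0 (by simp)
      all_goals rfl
    | succ n =>
      rw [quasiIsoAt_iff_exactAt']
      · exact twoTermComplex_exactAt_succ S.f n
      · apply ChainComplex.exactAt_succ_single_obj⟩

/-- Applying `F` to the two-term resolution leaves nothing in degrees at least 2, and the homology
in degree 1 is the kernel of `F.map S.f`. -/
lemma isZero_leftDerived_iff_mono {D : Type*} [Category* D] [Abelian D]
    [HasProjectiveResolutions C] {S : ShortComplex C} (hS : S.ShortExact)
    [Projective S.X₁] [Projective S.X₂] (F : C ⥤ D) [F.Additive] :
    (∀ i : ℕ, 0 < i → IsZero ((F.leftDerived i).obj S.X₃)) ↔ Mono (F.map S.f) := by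
  let K := (F.mapHomologicalComplex _).obj (twoTermComplex S.f)
  have key (i : ℕ) : IsZero ((F.leftDerived i).obj S.X₃) ↔ K.ExactAt i := by
    rw [exactAt_iff_isZero_homology]
    exact ((shortProjectiveResolution hS).isoLeftDerivedObj F i).isZero_iff
  have hz (i : ℕ) (hi : 2 ≤ i) : IsZero (K.X i) := F.map_isZero (isZero_twoTermComplex_X S.f hi)
  have h1 : K.ExactAt 1 ↔ Mono (F.map S.f) := by
    rw [exactAt_one_of_isZero_iff_mono _ (hz 2 le_rfl)]
    change Mono (F.map ((twoTermComplex S.f).d 1 0)) ↔ _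
    refine ⟨fun h => ?_, fun h => ?_⟩
    · rw [show S.f = (twoTermComplexXOneIso S.f).inv ≫ (twoTermComplex S.f).d 1 0 ≫
        (twoTermComplexXZeroIso S.f).hom by rw [← twoTermComplex_hom_comp]; simp,
        F.map_comp, F.map_comp]
      infer_instance
    · rw [twoTermComplex_d, F.map_comp, F.map_comp]
      infer_instance
  refine ⟨fun h => h1.1 ((key 1).1 (h 1 one_pos)), fun h i hi => (key i).2 ?_⟩
  match i, hi with
  | 1, _ => exact h1.2 h
  | i + 2, _ => exact ShortComplex.exact_of_isZero_X₂ _ (hz _ (by omega))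

end ShortResolution

/-- Tensoring the resolution `0 → T → T → T/(f) → 0` with `M` turns its differential into
multiplication by `f` on `M`. -/
lemma isZero_tor_quotient_span_singleton_iff {T : Type u} [CommRing T] {f : T}
    (hf : f ∈ nonZeroDivisors T) (M : Type u) [AddCommGroup M] [Module T M] :
    (∀ i : ℕ, 0 < i → CategoryTheory.Limits.IsZero
      (((CategoryTheory.Tor (ModuleCat.{u} T) i).obj (ModuleCat.of T M)).obj
        (ModuleCat.of T (T ⧸ Ideal.span {f})))) ↔ IsSMulRegular M f := by
  let S : CategoryTheory.ShortComplex (ModuleCat.{u} T) :=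
    { X₁ := ModuleCat.of T T
      X₂ := ModuleCat.of T T
      X₃ := ModuleCat.of T (T ⧸ Ideal.span {f})
      f := ModuleCat.ofHom (LinearMap.lsmul T T f)
      g := ModuleCat.ofHom (Submodule.mkQ (Ideal.span {f}))
      zero := by
        ext
        change Submodule.mkQ (Ideal.span {f}) (f * 1) = 0
        rw [Submodule.mkQ_apply, Submodule.Quotient.mk_eq_zero, mul_one]
        exact Ideal.mem_span_singleton_self f }
  have hS : S.ShortExact :=
    { exact := by
        rw [CategoryTheory.ShortComplex.ShortExact.moduleCat_exact_iff_function_exact]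
        intro x
        change Submodule.mkQ (Ideal.span {f}) x = 0 ↔ x ∈ Set.range fun y => f * y
        rw [Submodule.mkQ_apply, Submodule.Quotient.mk_eq_zero, Ideal.mem_span_singleton,
          dvd_iff_exists_eq_mul_right]
        exact exists_congr fun _ => eq_comm
      mono_f := (ModuleCat.mono_iff_injective _).2 fun a b h =>
        (mul_cancel_left_mem_nonZeroDivisors hf).1 h
      epi_g := (ModuleCat.epi_iff_surjective _).2 (Submodule.mkQ_surjective _) }
  have : CategoryTheory.Projective S.X₁ :=
    inferInstanceAs (CategoryTheory.Projective (ModuleCat.of T T))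
  have : CategoryTheory.Projective S.X₂ :=
    inferInstanceAs (CategoryTheory.Projective (ModuleCat.of T T))
  refine (isZero_leftDerived_iff_mono hS
    ((CategoryTheory.MonoidalCategory.tensoringLeft (ModuleCat.{u} T)).obj
      (ModuleCat.of T M))).trans ?_
  rw [ModuleCat.mono_iff_injective]
  change Function.Injective (LinearMap.lTensor M (LinearMap.lsmul T T f)) ↔ _
  have e : (TensorProduct.rid T M).toLinearMap ∘ₗ (LinearMap.lTensor M (LinearMap.lsmul T T f)) =
      LinearMap.lsmul T M f ∘ₗ (TensorProduct.rid T M).toLinearMap := by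
    ext; simp
  have e' : Function.Injective
        ((TensorProduct.rid T M) ∘ (LinearMap.lTensor M (LinearMap.lsmul T T f))) ↔
      Function.Injective ((fun m : M => f • m) ∘ (TensorProduct.rid T M)) := by
    rw [show (TensorProduct.rid T M) ∘ (LinearMap.lTensor M (LinearMap.lsmul T T f)) =
      (fun m : M => f • m) ∘ (TensorProduct.rid T M) from congrArg DFunLike.coe e]
  rw [(TensorProduct.rid T M).injective.of_comp_iff,
    Function.Injective.of_comp_iff' _ (TensorProduct.rid T M).bijective] at e'
  exact e'

/-! ### Weak liftability and maps `I → T/I` -/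

namespace WeakLifting

section

variable {T : Type u} [CommRing T]

lemma weaklyLiftable_of_retraction {R : Type u} [CommRing R] [Algebra T R]
    {M' M : Type u} [AddCommGroup M'] [Module T M'] [AddCommGroup M] [Module R M]
    [Module.Finite T M']
    (htor : ∀ i : ℕ, 0 < i → CategoryTheory.Limits.IsZero
      (((CategoryTheory.Tor (ModuleCat.{u} T) i).obj (ModuleCat.of T M')).obj (ModuleCat.of T R)))
    (π : R ⊗[T] M' →ₗ[R] M) (σ : M →ₗ[R] R ⊗[T] M') (h : π ∘ₗ σ = LinearMap.id) :
    WeaklyLiftable T R M := by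
  have h' (m : M) : π (σ m) = m := LinearMap.congr_fun h m
  refine ⟨R ⊗[T] M', inferInstance, inferInstance, LinearMap.ker π, inferInstance, inferInstance,
    ⟨M', inferInstance, inferInstance, inferInstance, ⟨LinearEquiv.refl _ _⟩, htor⟩, ⟨?_⟩⟩
  refine LinearEquiv.ofLinearMap
    (LinearMap.prod π (LinearMap.codRestrict _ (LinearMap.id - σ ∘ₗ π) fun x => by simp [h']))
    (LinearMap.coprod σ (LinearMap.ker π).subtype) ?_ ?_
  · ext x
    · simp [h']
    · simp [h']
    · simp
    · simp
  · ext x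
    simp

lemma mk_one_tmul_eq_zero {J : Ideal T} {M : Type u} [AddCommGroup M] [Module T M] {m : M}
    (h : (1 : T ⧸ J) ⊗ₜ[T] m = 0) : m ∈ (J • ⊤ : Submodule T M) := by
  have := congrArg (TensorProduct.quotTensorEquivQuotSMul M J) h
  rw [map_zero, ← map_one (Ideal.Quotient.mk J),
    TensorProduct.quotTensorEquivQuotSMul_mk_tmul, one_smul] at this
  exact (Submodule.Quotient.mk_eq_zero _).1 this

lemma exists_one_tmul_eq {J : Ideal T} {M : Type u} [AddCommGroup M] [Module T M]
    (x : (T ⧸ J) ⊗[T] M) : ∃ m : M, (1 : T ⧸ J) ⊗ₜ[T] m = x := by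
  induction x with
  | zero => exact ⟨0, TensorProduct.tmul_zero _ _⟩
  | tmul r m =>
    obtain ⟨t, rfl⟩ := Ideal.Quotient.mk_surjective r
    refine ⟨t • m, ?_⟩
    rw [← TensorProduct.smul_tmul, Algebra.smul_def, mul_one]
    rfl
  | add x y hx hy =>
    obtain ⟨a, rfl⟩ := hx
    obtain ⟨b, rfl⟩ := hy
    exact ⟨a + b, TensorProduct.tmul_add _ _ _⟩

/-- `T/I` weakly lifts to `T` if and only if some linear map `I → T/I` takes `f` to `1`. -/
lemma quotientWeaklyLiftable_iff [IsNoetherianRing T] {f : T} (hf : f ∈ nonZeroDivisors T)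
    {I : Ideal T} (hfI : f ∈ I) :
    QuotientWeaklyLiftable I f hfI ↔ ∃ φ : I →ₗ[T] T ⧸ I, φ ⟨f, hfI⟩ = 1 := by
  let : Module (T ⧸ Ideal.span {f}) (T ⧸ I) := Module.compHom (T ⧸ I) (quotMap hfI)
  have hsmul (t : T) (x : T ⧸ I) : algebraMap T (T ⧸ Ideal.span {f}) t • x = t • x := by
    change quotMap hfI (Ideal.Quotient.mk _ t) * x = _
    rw [quotMap, Ideal.Quotient.factor_mk, Algebra.smul_def]
    rfl
  have : IsScalarTower T (T ⧸ Ideal.span {f}) (T ⧸ I) := .of_algebraMap_smul hsmul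
  constructor
  · rintro ⟨L, _, _, N, _, _, ⟨M', _, _, _, ⟨e₁⟩, htor⟩, ⟨e₂⟩⟩
    rw [isZero_tor_quotient_span_singleton_iff hf] at htor
    let e := e₁.trans e₂
    let π : M' →ₗ[T] T ⧸ I :=
      (LinearMap.fst _ _ _ ∘ₗ e.toLinearMap).restrictScalars T ∘ₗ TensorProduct.mk T _ M' 1
    obtain ⟨m, hm⟩ := exists_one_tmul_eq (e.symm (1, 0))
    have hπ : π m = 1 := by
      simp [π, hm]
    let g : M' →ₗ[T] M' := LinearMap.lsmul T M' f
    have hg : Function.Injective g := htor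
    -- `I` kills the summand `T/I`, so `im` vanishes in `M'/fM'`. Injectivity of `g` then allows
    -- dividing by `f`.
    have hmem (i : I) : (i : T) • m ∈ LinearMap.range g := by
      have h0 : (1 : T ⧸ Ideal.span {f}) ⊗ₜ[T] ((i : T) • m) = 0 := by
        rw [TensorProduct.tmul_smul, hm, ← algebraMap_smul (T ⧸ Ideal.span {f}), ← map_smul,
          Prod.smul_mk, smul_zero, hsmul, Algebra.smul_def, mul_one, Ideal.Quotient.algebraMap_eq,
          Ideal.Quotient.eq_zero_iff_mem.2 i.2]
        exact map_zero _
      have h1 := mk_one_tmul_eq_zero h0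
      rw [Submodule.ideal_span_singleton_smul] at h1
      obtain ⟨x, -, hx⟩ := Submodule.mem_smul_pointwise_iff_exists _ _ _ |>.1 h1
      exact ⟨x, hx⟩
    let ψ : I →ₗ[T] LinearMap.range g :=
      LinearMap.codRestrict _ (LinearMap.toSpanSingleton T M' m ∘ₗ I.subtype) hmem
    refine ⟨π ∘ₗ (LinearEquiv.ofInjective g hg).symm.toLinearMap ∘ₗ ψ, ?_⟩
    have : ψ ⟨f, hfI⟩ = LinearEquiv.ofInjective g hg m := rfl
    simp [this, hπ]
  · rintro ⟨φ, hφ⟩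
    have hreg : IsSMulRegular I f := fun a b h =>
      Subtype.ext ((mul_cancel_left_mem_nonZeroDivisors hf).1 (congrArg Subtype.val h))
    -- In `I/fI` the element `i·f` equals `f·i`, hence is zero; so `1 ↦ f` is well defined on `T/I`,
    -- and `φ` induces its retraction.
    have hker : I ≤ LinearMap.ker (LinearMap.toSpanSingleton T ((T ⧸ Ideal.span {f}) ⊗[T] I)
        (1 ⊗ₜ ⟨f, hfI⟩)) := by
      intro i hi
      rw [LinearMap.mem_ker, LinearMap.toSpanSingleton_apply, ← TensorProduct.tmul_smul,
        show i • (⟨f, hfI⟩ : I) = f • ⟨i, hi⟩ from Subtype.ext (mul_comm _ _),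
        ← TensorProduct.smul_tmul, Algebra.smul_def, mul_one, Ideal.Quotient.algebraMap_eq,
        Ideal.Quotient.eq_zero_iff_mem.2 (Ideal.mem_span_singleton_self f), TensorProduct.zero_tmul]
    let σ : (T ⧸ I) →ₗ[T] (T ⧸ Ideal.span {f}) ⊗[T] I := Submodule.liftQ I _ hker
    have hsurj : Function.Surjective (algebraMap T (T ⧸ Ideal.span {f})) :=
      Ideal.Quotient.mk_surjective
    let π : (T ⧸ Ideal.span {f}) ⊗[T] I →ₗ[T ⧸ Ideal.span {f}] T ⧸ I :=
      TensorProduct.AlgebraTensorModule.lift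
        ((LinearMap.lsmul (T ⧸ Ideal.span {f}) (I →ₗ[T] T ⧸ I)).flip φ)
    refine weaklyLiftable_of_retraction
      ((isZero_tor_quotient_span_singleton_iff hf I).2 hreg) π
      (σ.extendScalarsOfSurjective hsurj) ?_
    refine LinearMap.ext fun x => ?_
    obtain ⟨t, rfl⟩ := Ideal.Quotient.mk_surjective x
    have hσ : σ (Ideal.Quotient.mk I t) = t • (1 ⊗ₜ ⟨f, hfI⟩) := rfl
    change π (σ (Ideal.Quotient.mk I t)) = _
    rw [hσ, ← algebraMap_smul (T ⧸ Ideal.span {f}), map_smul]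
    simp only [π, TensorProduct.AlgebraTensorModule.lift_tmul, LinearMap.flip_apply,
      LinearMap.lsmul_apply, one_smul, hφ, hsmul, Algebra.smul_def, mul_one]
    rfl

end

end WeakLifting

/-! ### Splittings, the row condition and colon ideals in terms of `φ` -/

namespace WeakLifting

section

variable {T : Type u} [CommRing T]

lemma mem_ideal_smul_top_pi_iff {m : ℕ} {I : Ideal T} {z : Fin m → T} :
    z ∈ (I • ⊤ : Submodule T (Fin m → T)) ↔ ∀ j, z j ∈ I := by
  constructor
  · intro hz j
    have h : (I • ⊤ : Submodule T (Fin m → T)) ≤ Submodule.comap (LinearMap.proj j) I :=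
      Submodule.smul_le.2 fun r hr n _ => I.mul_mem_right _ hr
    exact h hz
  · intro hz
    rw [pi_eq_sum_univ' z]
    exact Submodule.sum_mem _ fun j _ => Submodule.smul_mem_smul (hz j) trivial

lemma linearMap_quotient_eq_id {I : Ideal T} {h : (T ⧸ I) →ₗ[T] T ⧸ I} (h1 : h 1 = 1) :
    h = LinearMap.id := by
  refine LinearMap.ext fun x => ?_
  obtain ⟨t, rfl⟩ := Ideal.Quotient.mk_surjective x
  have : Ideal.Quotient.mk I t = t • (1 : T ⧸ I) := by
    rw [Algebra.smul_def, mul_one]; rfl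
  rw [this, map_smul, h1]; rfl

/-- `I` kills `T/I`. Used with `J = (f)` and `J = I` to descend `φ` to `I/fI` and `I/I²`. -/
lemma smul_top_le_ker {I J : Ideal T} (hJ : J ≤ I) (φ : I →ₗ[T] T ⧸ I) :
    (J • ⊤ : Submodule T I) ≤ LinearMap.ker φ := by
  refine Submodule.smul_le.2 fun r hr n _ => ?_
  rw [LinearMap.mem_ker, map_smul, Algebra.smul_def, Ideal.Quotient.algebraMap_eq,
    Ideal.Quotient.eq_zero_iff_mem.2 (hJ hr), zero_mul]

lemma splits_mapToModF_iff {f : T} {I : Ideal T} (hfI : f ∈ I) :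
    Splits (mapToModF I f hfI) ↔ ∃ φ : I →ₗ[T] T ⧸ I, φ ⟨f, hfI⟩ = 1 := by
  have h1 : mapToModF I f hfI 1 = Submodule.Quotient.mk ⟨f, hfI⟩ := by
    change (1 : T) • (Submodule.Quotient.mk _ : I ⧸ (Ideal.span {f} • ⊤ : Submodule T I)) = _
    exact one_smul _ _
  constructor
  · rintro ⟨s, hs⟩
    refine ⟨s ∘ₗ Submodule.mkQ _, ?_⟩
    have := LinearMap.congr_fun hs 1
    rwa [LinearMap.comp_apply, h1] at this
  · rintro ⟨φ, hφ⟩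
    refine ⟨Submodule.liftQ _ φ
      (smul_top_le_ker ((Ideal.span_singleton_le_iff_mem I).2 hfI) φ),
      linearMap_quotient_eq_id ?_⟩
    rwa [LinearMap.comp_apply, h1, Submodule.liftQ_apply]

lemma splits_mapToCotangent_iff {f : T} {I : Ideal T} (hfI : f ∈ I) :
    Splits (mapToCotangent I f hfI) ↔ ∃ φ : I →ₗ[T] T ⧸ I, φ ⟨f, hfI⟩ = 1 := by
  have h1 : mapToCotangent I f hfI 1 = I.toCotangent ⟨f, hfI⟩ := by
    change (1 : T) • I.toCotangent _ = _
    exact one_smul _ _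
  constructor
  · rintro ⟨s, hs⟩
    refine ⟨s ∘ₗ I.toCotangent, ?_⟩
    have := LinearMap.congr_fun hs 1
    rwa [LinearMap.comp_apply, h1] at this
  · rintro ⟨φ, hφ⟩
    let s : I.Cotangent →ₗ[T] T ⧸ I := Submodule.liftQ _ φ (smul_top_le_ker le_rfl φ)
    exact ⟨s, linearMap_quotient_eq_id <| by rw [LinearMap.comp_apply, h1]; exact hφ⟩

lemma IsPresentation.linearCombination_col {k m : ℕ} {v : Fin k → T}
    {X : Matrix (Fin k) (Fin m) T} (hX : IsPresentation v X) (j : Fin m) :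
    ∑ i, X i j * v i = 0 := by
  have := (hX (X.mulVecLin (Pi.single j 1))).2 ⟨_, rfl⟩
  simpa [Fintype.linearCombination_apply] using this

lemma IsPresentation.exists_of_isNoetherianRing [IsNoetherianRing T] {k : ℕ} (v : Fin k → T) :
    ∃ (m : ℕ) (X : Matrix (Fin k) (Fin m) T), IsPresentation v X := by
  obtain ⟨m, g, hg⟩ := Submodule.fg_iff_exists_fin_generating_family.1
    (IsNoetherian.noetherian (LinearMap.ker (Fintype.linearCombination T v)))
  refine ⟨m, Matrix.of fun i j => g j i, fun z => ?_⟩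
  rw [← LinearMap.mem_ker, ← hg, ← LinearMap.coe_range, Matrix.range_mulVecLin]
  rfl

/-- Each column of `X` is a relation on the generators; `φ` turns it into a congruence modulo `I`.
The coefficients are minus lifts of `φ(f_i)`. -/
lemma rowCondition_of_linearMap {f : T} {I : Ideal T} (hfI : f ∈ I) {n m : ℕ} {fs : Fin n → T}
    (hfs : ∀ i, fs i ∈ I) {X : Matrix (Fin (n + 1)) (Fin m) T}
    (hX : IsPresentation (Fin.cons f fs : Fin (n + 1) → T) X) {φ : I →ₗ[T] T ⧸ I}
    (hφ : φ ⟨f, hfI⟩ = 1) : RowCondition I X := by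
  choose y hy using fun i => Ideal.Quotient.mk_surjective (φ ⟨fs i, hfs i⟩)
  refine ⟨fun i => -y i, mem_ideal_smul_top_pi_iff.2 fun j => ?_⟩
  have h := hX.linearCombination_col j
  rw [Fin.sum_univ_succ] at h
  simp only [Fin.cons_zero, Fin.cons_succ] at h
  have h' : X 0 j • (⟨f, hfI⟩ : I) + ∑ i, X i.succ j • (⟨fs i, hfs i⟩ : I) = 0 := by
    apply Subtype.ext
    simpa using h
  have h2 := congrArg φ h'
  simp only [map_add, map_smul, map_sum, hφ, map_zero, ← hy] at h2
  rw [← Ideal.Quotient.eq_zero_iff_mem, ← h2]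
  simp [Algebra.smul_def, Finset.sum_apply, mul_comm]

lemma linearMap_of_rowCondition {f : T} {I : Ideal T} (hfI : f ∈ I) {n m : ℕ} {fs : Fin n → T}
    (hI : Ideal.span (Set.range (Fin.cons f fs : Fin (n + 1) → T)) = I)
    {X : Matrix (Fin (n + 1)) (Fin m) T}
    (hX : IsPresentation (Fin.cons f fs : Fin (n + 1) → T) X) (h : RowCondition I X) :
    ∃ φ : I →ₗ[T] T ⧸ I, φ ⟨f, hfI⟩ = 1 := by
  obtain ⟨x, hx⟩ := h
  rw [mem_ideal_smul_top_pi_iff] at hx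
  let v : Fin (n + 1) → T := Fin.cons f fs
  have hrange : LinearMap.range (Fintype.linearCombination T v) = I := by
    rw [Fintype.range_linearCombination]; exact hI
  let V : (Fin (n + 1) → T) →ₗ[T] I := LinearMap.codRestrict I (Fintype.linearCombination T v)
    fun z => hrange ▸ ⟨z, rfl⟩
  have hV : Function.Surjective V := fun ⟨i, hi⟩ => by
    rw [← hrange] at hi
    obtain ⟨z, hz⟩ := hi
    exact ⟨z, Subtype.ext hz⟩
  -- The intended values of `φ` on the generators: `f ↦ 1`, `f_i ↦ -x_i`. The row condition says
  -- that `w` kills the columns of `X`, hence all relations.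
  let w : (Fin (n + 1) → T) →ₗ[T] T ⧸ I :=
    Submodule.mkQ I ∘ₗ Fintype.linearCombination T (Fin.cons 1 (fun i => -x i) : Fin (n + 1) → T)
  have hker : LinearMap.ker V ≤ LinearMap.ker w := by
    intro z hz
    obtain ⟨c, rfl⟩ := (hX z).1 (congrArg Subtype.val hz)
    rw [LinearMap.mem_ker, LinearMap.comp_apply, Submodule.mkQ_apply,
      Submodule.Quotient.mk_eq_zero]
    have : Fintype.linearCombination T (Fin.cons 1 (fun i => -x i) : Fin (n + 1) → T)
        (X.mulVecLin c) = ∑ j, c j * (X 0 - ∑ i : Fin n, x i • X i.succ) j := by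
      simp only [Fintype.linearCombination_apply, Matrix.mulVecLin_apply, Matrix.mulVec,
        dotProduct, smul_eq_mul, Finset.sum_mul]
      rw [Finset.sum_comm]
      refine Finset.sum_congr rfl fun j _ => ?_
      simp only [Fin.sum_univ_succ, Fin.cons_zero, Fin.cons_succ, mul_one, Pi.sub_apply,
        Finset.sum_apply, Pi.smul_apply, smul_eq_mul, mul_neg, Finset.sum_neg_distrib, mul_sub,
        Finset.mul_sum, ← sub_eq_add_neg]
      congr 1
      · exact mul_comm _ _
      · exact Finset.sum_congr rfl fun _ _ => by ring
    rw [this]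
    exact I.sum_mem fun j _ => I.mul_mem_left _ (hx j)
  refine ⟨Submodule.liftQ _ w hker ∘ₗ (V.quotKerEquivOfSurjective hV).symm.toLinearMap, ?_⟩
  have hf : V.quotKerEquivOfSurjective hV (Submodule.Quotient.mk (Pi.single 0 1)) = ⟨f, hfI⟩ := by
    apply Subtype.ext
    change Fintype.linearCombination T v (Pi.single 0 1) = f
    simp [v]
  rw [← hf, LinearMap.comp_apply, LinearEquiv.coe_coe, LinearEquiv.symm_apply_apply,
    Submodule.liftQ_apply]
  simp only [w, LinearMap.comp_apply, Fintype.linearCombination_apply_single, Fin.cons_zero,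
    smul_eq_mul, mul_one]
  rfl

/-- By linearity `φ` maps `IJ` into `J·(T/I) = (J + I)/I`, while `φ(af)` is the class of `a`. -/
lemma colon_le_sup_of_linearMap {f : T} {I : Ideal T} {hfI : f ∈ I} {φ : I →ₗ[T] T ⧸ I}
    (hφ : φ ⟨f, hfI⟩ = 1) (J : Ideal T) : (I * J).colon {f} ≤ J ⊔ I := by
  have key : (I * J : Ideal T) ≤ Submodule.map I.subtype
      (Submodule.comap φ (Submodule.map (Submodule.mkQ I) (J : Submodule T T))) := by
    refine Ideal.mul_le.2 fun i hi j hj => ?_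
    refine ⟨j • ⟨i, hi⟩, ?_, mul_comm j i⟩
    obtain ⟨t, ht⟩ := Submodule.mkQ_surjective I (φ ⟨i, hi⟩)
    refine ⟨t * j, J.mul_mem_left t hj, ?_⟩
    rw [map_smul, ← ht, ← map_smul, smul_eq_mul, mul_comm]
  intro a ha
  rw [Submodule.mem_colon_singleton] at ha
  obtain ⟨y, ⟨b, hb, hb'⟩, hy⟩ := key ha
  obtain rfl : y = a • ⟨f, hfI⟩ := Subtype.ext hy
  rw [map_smul, hφ] at hb'
  have : b - a ∈ I := by
    rw [← Submodule.Quotient.mk_eq_zero I, Submodule.Quotient.mk_sub, sub_eq_zero]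
    refine hb'.trans ?_
    rw [Algebra.smul_def, mul_one]
    rfl
  rw [show a = b - (b - a) by ring]
  exact sub_mem (Ideal.mem_sup_left hb) (Ideal.mem_sup_right this)

lemma forall_colon_le_sup_iff (I : Ideal T) (f : T) :
    (∀ J : Ideal T, (I * J).colon {f} ≤ J ⊔ I) ↔
      ∀ J : Ideal T, I ≤ J → (I * J).colon {f} ≤ J := by
  refine ⟨fun h J hJ => (h J).trans (sup_le le_rfl hJ), fun h J => ?_⟩
  exact (Submodule.colon_mono (Ideal.mul_mono le_rfl le_sup_left) subset_rfl).trans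
    (h (J ⊔ I) le_sup_right)

/-- In a Noetherian ring `J` is a finite intersection of irreducible ideals `K`, and `(IJ : f) ⊆ (IK
: f) ⊆ K` for each of them. -/
lemma forall_colon_le_iff_forall_infIrred [IsNoetherianRing T] (I : Ideal T) (f : T) :
    (∀ J : Ideal T, I ≤ J → (I * J).colon {f} ≤ J) ↔
      ∀ J : Ideal T, InfIrred J → I ≤ J → (I * J).colon {f} ≤ J := by
  refine ⟨fun h J _ => h J, fun h J hJ => ?_⟩
  obtain ⟨s, rfl, hs⟩ := exists_infIrred_decomposition J
  refine Finset.le_inf fun K hK => ?_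
  have hle : s.inf id ≤ K := Finset.inf_le (f := id) hK
  exact (Submodule.colon_mono (Ideal.mul_mono le_rfl hle) subset_rfl).trans
    (h K (hs hK) (hJ.trans hle))

end

end WeakLifting

/-! ### Finite injective dimension when the maximal ideal has no nonzerodivisor -/

section

open CategoryTheory Abelian

variable {S : Type u} [CommRing S]

/-- The short complex of modules given by an exact pair of linear maps. -/
abbrev Function.Exact.shortComplex {A B C : Type u} [AddCommGroup A] [Module S A]
    [AddCommGroup B] [Module S B] [AddCommGroup C] [Module S C] {f : A →ₗ[S] B} {g : B →ₗ[S] C}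
    (h : Function.Exact f g) : ShortComplex (ModuleCat.{u} S) :=
  ShortComplex.mk (ModuleCat.ofHom f) (ModuleCat.ofHom g)
    (ModuleCat.hom_ext h.linearMap_comp_eq_zero)

lemma Function.Exact.shortComplex_shortExact {A B C : Type u} [AddCommGroup A] [Module S A]
    [AddCommGroup B] [Module S B] [AddCommGroup C] [Module S C] {f : A →ₗ[S] B} {g : B →ₗ[S] C}
    (h : Function.Exact f g) (hf : Function.Injective f) (hg : Function.Surjective g) :
    h.shortComplex.ShortExact where
  exact := (ShortComplex.ShortExact.moduleCat_exact_iff_function_exact _).mpr h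
  mono_f := (ModuleCat.mono_iff_injective _).mpr hf
  epi_g := (ModuleCat.epi_iff_surjective _).mpr hg

/-- Multiplication by `x` as a map `S/𝔟 → S/𝔞` when `𝔟` is the colon ideal `(𝔞 : x)`. -/
def mulQuotient {𝔞 𝔟 : Ideal S} {x : S} (h : ∀ s, s * x ∈ 𝔞 ↔ s ∈ 𝔟) : (S ⧸ 𝔟) →ₗ[S] S ⧸ 𝔞 :=
  Submodule.mapQ 𝔟 𝔞 (LinearMap.mulRight S x) fun s hs => (h s).2 hs

lemma mulQuotient_injective {𝔞 𝔟 : Ideal S} {x : S} (h : ∀ s, s * x ∈ 𝔞 ↔ s ∈ 𝔟) :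
    Function.Injective (mulQuotient h) := by
  rw [injective_iff_map_eq_zero]
  intro y hy
  obtain ⟨s, rfl⟩ := Submodule.mkQ_surjective _ y
  exact (Submodule.Quotient.mk_eq_zero _).2 ((h s).1 ((Submodule.Quotient.mk_eq_zero _).1 hy))

lemma mulQuotient_exact {𝔞 𝔟 : Ideal S} {x : S} (h : ∀ s, s * x ∈ 𝔞 ↔ s ∈ 𝔟) :
    Function.Exact (mulQuotient h) (Submodule.factor (p := 𝔞) (p' := 𝔞 ⊔ Ideal.span {x})
      le_sup_left) := by
  intro y
  obtain ⟨s, rfl⟩ := Submodule.mkQ_surjective _ y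
  constructor
  · intro hs
    replace hs : s ∈ 𝔞 ⊔ Ideal.span {x} := (Submodule.Quotient.mk_eq_zero _).1 hs
    obtain ⟨a, ha, b, hb, hab⟩ := Submodule.mem_sup.1 hs
    obtain ⟨c, rfl⟩ := Ideal.mem_span_singleton'.1 hb
    refine ⟨Submodule.Quotient.mk c, ?_⟩
    refine (Submodule.Quotient.eq _).2 ?_
    rw [LinearMap.mulRight_apply, ← hab, sub_add_cancel_right]
    exact neg_mem ha
  · rintro ⟨z, hz⟩
    obtain ⟨c, rfl⟩ := Submodule.mkQ_surjective _ z
    rw [← hz]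
    exact (Submodule.Quotient.mk_eq_zero _).2
      (Ideal.mem_sup_right (Ideal.mul_mem_left _ c (Ideal.mem_span_singleton_self x)))

/-- The exact sequence `0 → S/(𝔞 : x) → S/𝔞 → S/(𝔞 + (x)) → 0`. -/
lemma mulQuotient_shortExact {𝔞 𝔟 : Ideal S} {x : S} (h : ∀ s, s * x ∈ 𝔞 ↔ s ∈ 𝔟) :
    (mulQuotient_exact h).shortComplex.ShortExact :=
  (mulQuotient_exact h).shortComplex_shortExact (mulQuotient_injective h)
    (Submodule.factor_surjective _)

/-- Noetherian induction on `𝔞`, from larger ideals down. If `xy ∈ 𝔞` with `x, y ∉ 𝔞`, then `S/𝔞` is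
an extension of `S/(𝔞 + (x))` by `S/(𝔞 : x)`, both covered by induction. If `𝔞` is a nonmaximal
prime, some `x` in the maximal ideal is regular on `S/𝔞`; by `htop` it acts surjectively on the
finitely generated Ext module, and Nakayama applies. -/
lemma ext_quotient_subsingleton_of_residueField [IsNoetherianRing S] [IsLocalRing S]
    (M : ModuleCat.{u} S) [Module.Finite S M] (d : ℕ)
    (htop : ∀ 𝔞 : Ideal S, Subsingleton (Ext (ModuleCat.of S (S ⧸ 𝔞)) M (d + 1)))
    (hk : Subsingleton (Ext (ModuleCat.of S (S ⧸ IsLocalRing.maximalIdeal S)) M d))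
    (𝔞 : Ideal S) : Subsingleton (Ext (ModuleCat.of S (S ⧸ 𝔞)) M d) := by
  induction 𝔞 using IsNoetherian.induction with
  | hgt 𝔞 ih =>
  by_cases ha : 𝔞 = ⊤
  · subst ha
    have : Limits.IsZero (ModuleCat.of S (S ⧸ (⊤ : Ideal S))) := by
      rw [ModuleCat.isZero_iff_subsingleton]
      exact Ideal.Quotient.subsingleton_iff.2 rfl
    refine subsingleton_of_forall_eq 0 fun e => ?_
    rw [← e.mk₀_id_comp, this.eq_zero_of_src (𝟙 _), Ext.mk₀_zero, Ext.zero_comp]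
  by_cases hm : 𝔞 = IsLocalRing.maximalIdeal S
  · exact hm ▸ hk
  by_cases hp : Ideal.IsPrime 𝔞
  · have hle := IsLocalRing.le_maximalIdeal ha
    obtain ⟨x, hx, hxa⟩ := SetLike.exists_of_lt (lt_of_le_of_ne hle hm)
    have h (s : S) : s * x ∈ 𝔞 ↔ s ∈ 𝔞 :=
      ⟨fun h => (hp.mem_or_mem h).resolve_right hxa, Ideal.mul_mem_right x 𝔞⟩
    have hf : ModuleCat.ofHom (mulQuotient h) = x • 𝟙 (ModuleCat.of S (S ⧸ 𝔞)) := by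
      refine ModuleCat.hom_ext (LinearMap.ext fun y => ?_)
      obtain ⟨s, rfl⟩ := Submodule.mkQ_surjective _ y
      exact congrArg (Submodule.Quotient.mk) (mul_comm s x)
    have hsurj (e : Ext (ModuleCat.of S (S ⧸ 𝔞)) M d) :
        ∃ e' : Ext (ModuleCat.of S (S ⧸ 𝔞)) M d, x • e' = e := by
      have := htop (𝔞 ⊔ Ideal.span {x})
      obtain ⟨e', he'⟩ := Ext.contravariant_sequence_exact₁ (mulQuotient_shortExact h) M e
        (add_comm 1 d) (Subsingleton.elim _ _)
      refine ⟨e', ?_⟩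
      rw [← he']
      change _ = (Ext.mk₀ (ModuleCat.ofHom (mulQuotient h))).comp e' _
      rw [hf, Ext.mk₀_smul, Ext.smul_comp, Ext.mk₀_id_comp]
    have hbot : (⊤ : Submodule S (Ext (ModuleCat.of S (S ⧸ 𝔞)) M d)) = ⊥ := by
      refine Submodule.eq_bot_of_le_smul_of_le_jacobson_bot (IsLocalRing.maximalIdeal S) _
        Module.Finite.fg_top ?_ (IsLocalRing.maximalIdeal_le_jacobson _)
      intro e _
      obtain ⟨e', rfl⟩ := hsurj e
      exact Submodule.smul_mem_smul hx trivial
    exact (Submodule.subsingleton_iff S).1 (subsingleton_of_bot_eq_top hbot.symm)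
  · obtain ⟨x, hx, y, hy, hxy⟩ := (Ideal.not_isPrime_iff.1 hp).resolve_left ha
    have h (s : S) : s * x ∈ 𝔞 ↔ s ∈ 𝔞.colon {x} := Submodule.mem_colon_singleton.symm
    have h₁ := ih (𝔞.colon {x}) (SetLike.lt_iff_le_and_exists.2 ⟨fun s hs =>
      (h s).1 (Ideal.mul_mem_right x 𝔞 hs), y, (h y).1 (by rwa [mul_comm]), hy⟩)
    have h₃ := ih (𝔞 ⊔ Ideal.span {x}) (SetLike.lt_iff_le_and_exists.2 ⟨le_sup_left, x,
      Ideal.mem_sup_right (Ideal.mem_span_singleton_self x), hx⟩)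
    refine subsingleton_of_forall_eq 0 fun e => ?_
    obtain ⟨e', he'⟩ := Ext.contravariant_sequence_exact₂ (mulQuotient_shortExact h) M
      (n := d) e (Subsingleton.elim _ _)
    rw [← he', Subsingleton.elim e' 0, Ext.comp_zero]

/-- Dimension shifting along an embedding into an injective reduces to `d = 0`, which is Baer's
criterion. -/
lemma hasInjectiveDimensionLE_of_ext_quotient (M : ModuleCat.{u} S) (d : ℕ)
    (h : ∀ 𝔞 : Ideal S, Subsingleton (Ext (ModuleCat.of S (S ⧸ 𝔞)) M (d + 1))) :
    HasInjectiveDimensionLE M d := by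
  induction d generalizing M with
  | zero =>
    rw [HasInjectiveDimensionLE, zero_add, ← injective_iff_hasInjectiveDimensionLT_one]
    refine Module.injective_object_of_injective_module (R := S) (M := M)
      (inj := Module.Baer.injective fun 𝔞 g => ?_)
    have hex : Function.Exact 𝔞.subtype (Submodule.mkQ 𝔞) := LinearMap.exact_subtype_mkQ 𝔞
    have := h 𝔞
    obtain ⟨e, he⟩ := Ext.contravariant_sequence_exact₁
      (hex.shortComplex_shortExact 𝔞.injective_subtype (Submodule.mkQ_surjective 𝔞)) M
      (n₀ := 0) (Ext.mk₀ (ModuleCat.ofHom g)) (n₁ := 1) rfl (Subsingleton.elim _ _)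
    obtain ⟨g', rfl⟩ := Ext.homEquiv₀.symm.surjective e
    rw [Ext.homEquiv₀_symm_apply, Ext.mk₀_comp_mk₀] at he
    have he' := Ext.homEquiv₀.symm.injective he
    exact ⟨g'.hom, fun x hx => congrArg (fun φ => φ.hom ⟨x, hx⟩) he'⟩
  | succ d ih =>
    obtain ⟨⟨E, hE, f, hf⟩⟩ := EnoughInjectives.presentation M
    let T := ShortComplex.mk f (Limits.cokernel.π f) (Limits.cokernel.condition f)
    have hT : T.ShortExact := { exact := ShortComplex.exact_cokernel f }
    refine (hT.hasInjectiveDimensionLT_X₃_iff d hE).1 (ih _ fun 𝔞 => ?_)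
    have := h 𝔞
    refine subsingleton_of_forall_eq 0 fun e => ?_
    obtain ⟨e', rfl⟩ := Ext.covariant_sequence_exact₃ _ hT e (n₁ := d + 1 + 1) rfl
      (Subsingleton.elim _ _)
    rw [e'.eq_zero_of_injective, Ext.zero_comp]

/-- A nonzero `y` killed by the maximal ideal embeds the residue field `k` in `S`. Since `S` is
projective, `Ext^(d+1)(k, S)` is a quotient of zero as soon as `Ext^(d+2)(S/(y), S) = 0`. So the
bound on the injective dimension drops step by step to 0. -/
lemma injective_self_of_disjoint_nonZeroDivisors [IsNoetherianRing S] [IsLocalRing S]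
    (h : Disjoint (IsLocalRing.maximalIdeal S : Set S) (nonZeroDivisors S)) (d : ℕ)
    (hd : HasInjectiveDimensionLE (ModuleCat.of S S) d) : Module.Injective S S := by
  induction d with
  | zero =>
    rw [HasInjectiveDimensionLE, zero_add, ← injective_iff_hasInjectiveDimensionLT_one] at hd
    exact Module.injective_module_of_injective_object S S
  | succ d ih =>
    refine ih (hasInjectiveDimensionLE_of_ext_quotient _ d
      (ext_quotient_subsingleton_of_residueField _ (d + 1) (fun 𝔞 =>
        HasInjectiveDimensionLT.subsingleton _ _ _ le_rfl _) ?_))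
    obtain ⟨-, y, hy, hy0⟩ := SetLike.lt_iff_le_and_exists.1
      (Ideal.bot_lt_annihilator_of_disjoint_nonZeroDivisors h)
    have hmem (s : S) : s * y ∈ (⊥ : Ideal S) ↔ s ∈ IsLocalRing.maximalIdeal S := by
      refine ⟨fun hs => ?_, fun hs => ?_⟩
      · rw [IsLocalRing.mem_maximalIdeal, mem_nonunits_iff]
        exact fun hu => hy0 ((hu.mul_right_eq_zero).1 hs)
      · rw [Module.mem_annihilator] at hy
        simpa [mul_comm] using congrArg Subtype.val (hy ⟨s, hs⟩)
    have : Projective (ModuleCat.of S (S ⧸ (⊥ : Ideal S))) :=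
      Projective.of_iso (P := ModuleCat.of S S)
        (Submodule.quotEquivOfEqBot (⊥ : Ideal S) rfl).symm.toModuleIso inferInstance
    refine subsingleton_of_forall_eq 0 fun e => ?_
    obtain ⟨e', rfl⟩ := Ext.contravariant_sequence_exact₁ (mulQuotient_shortExact hmem) _ e
      (add_comm 1 (d + 1))
      (Ext.eq_zero_of_hasInjectiveDimensionLT _ (d + 1 + 1) le_rfl)
    rw [show e' = 0 from Ext.eq_zero_of_projective (P := ModuleCat.of S (S ⧸ (⊥ : Ideal S))) _,
      Ext.comp_zero]

end

/-! ### Injective dimension modulo a nonzerodivisor, and self-injective quotients -/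

section

open CategoryTheory Abelian

variable {S : Type u} [CommRing S]

lemma Module.Injective.smul_surjective {E : Type u} [AddCommGroup E] [Module S E]
    (hE : Module.Injective S E) {x : S} (hx : x ∈ nonZeroDivisors S) :
    Function.Surjective fun e : E => x • e := by
  intro e
  obtain ⟨g, hg⟩ := hE.out (LinearMap.mulLeft S x)
    (fun a b h => (mul_cancel_left_mem_nonZeroDivisors hx).1 h) (LinearMap.toSpanSingleton S E e)
  refine ⟨g 1, ?_⟩
  have := hg 1
  rw [LinearMap.toSpanSingleton_apply, one_smul] at this
  rw [← this, LinearMap.mulLeft_apply, ← smul_eq_mul, map_smul]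

instance (x : S) {A : Type u} [AddCommGroup A] [Module S A] :
    IsScalarTower S (S ⧸ Ideal.span {x}) (Submodule.torsionBy S A x) :=
  inferInstanceAs (IsScalarTower S (S ⧸ Submodule.span S {x}) (Submodule.torsionBy S A x))

variable (x : S)

/-- The map induced on `x`-torsion, as a map of `S/(x)`-modules. -/
def torsionByMap {A B : Type u} [AddCommGroup A] [Module S A] [AddCommGroup B] [Module S B]
    (f : A →ₗ[S] B) :
    Submodule.torsionBy S A x →ₗ[S ⧸ Ideal.span {x}] Submodule.torsionBy S B x :=
  (f.restrict (p := Submodule.torsionBy S A x) (q := Submodule.torsionBy S B x) fun a ha => by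
    rw [Submodule.mem_torsionBy_iff] at ha ⊢
    rw [← map_smul, ha, map_zero]).extendScalarsOfSurjective Ideal.Quotient.mk_surjective

@[simp]
lemma coe_torsionByMap {A B : Type u} [AddCommGroup A] [Module S A] [AddCommGroup B] [Module S B]
    (f : A →ₗ[S] B) (a : Submodule.torsionBy S A x) : (torsionByMap x f a : B) = f a := rfl

lemma torsionByMap_injective {A B : Type u} [AddCommGroup A] [Module S A] [AddCommGroup B]
    [Module S B] {f : A →ₗ[S] B} (hf : Function.Injective f) :
    Function.Injective (torsionByMap x f) :=
  fun _ _ h => Subtype.ext (hf (congrArg Subtype.val h))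

lemma torsionByMap_exact {A B C : Type u} [AddCommGroup A] [Module S A] [AddCommGroup B]
    [Module S B] [AddCommGroup C] [Module S C] {f : A →ₗ[S] B} {g : B →ₗ[S] C}
    (hf : Function.Injective f) (h : Function.Exact f g) :
    Function.Exact (torsionByMap x f) (torsionByMap x g) := by
  intro b
  constructor
  · intro hb
    obtain ⟨a, ha⟩ := (h b).1 (congrArg Subtype.val hb)
    refine ⟨⟨a, ?_⟩, Subtype.ext ha⟩
    rw [Submodule.mem_torsionBy_iff]
    apply hf
    rw [map_smul, ha, map_zero, Submodule.smul_coe_torsionBy]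
  · rintro ⟨a, rfl⟩
    exact Subtype.ext (h.apply_apply_eq_zero _)

/-- By the snake lemma the obstruction lies in `A/xA`, which vanishes here. -/
lemma torsionByMap_surjective {A B C : Type u} [AddCommGroup A] [Module S A] [AddCommGroup B]
    [Module S B] [AddCommGroup C] [Module S C] {f : A →ₗ[S] B} {g : B →ₗ[S] C}
    (h : Function.Exact f g) (hg : Function.Surjective g)
    (hA : Function.Surjective fun a : A => x • a) : Function.Surjective (torsionByMap x g) := by
  rintro ⟨c, hc⟩
  obtain ⟨b, rfl⟩ := hg c
  rw [Submodule.mem_torsionBy_iff, ← map_smul] at hc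
  obtain ⟨a, ha⟩ := (h _).1 hc
  obtain ⟨a, rfl⟩ := hA a
  refine ⟨⟨b - f a, ?_⟩, Subtype.ext ?_⟩
  · rw [Submodule.mem_torsionBy_iff, smul_sub, ← ha, map_smul, sub_self]
  · simp [h.apply_apply_eq_zero]

/-- The `x`-torsion of `E` is `Hom(S/(x), E)`: any `S`-linear extension to `S/(x)` takes values in
it. -/
lemma Module.Injective.torsionBy {E : Type u} [AddCommGroup E] [Module S E]
    (hE : Module.Injective S E) :
    Module.Injective (S ⧸ Ideal.span {x}) (Submodule.torsionBy S E x) := by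
  refine Module.Baer.injective fun 𝔞 g => ?_
  obtain ⟨h, hh⟩ := hE.out (𝔞.subtype.restrictScalars S) 𝔞.injective_subtype
    ((Submodule.torsionBy S E x).subtype ∘ₗ g.restrictScalars S)
  have hmem (y : S ⧸ Ideal.span {x}) : h y ∈ Submodule.torsionBy S E x := by
    rw [Submodule.mem_torsionBy_iff, ← map_smul, Algebra.smul_def, Ideal.Quotient.algebraMap_eq,
      Ideal.Quotient.eq_zero_iff_mem.2 (Ideal.mem_span_singleton_self x), zero_mul, map_zero]
  exact ⟨(h.codRestrict _ hmem).extendScalarsOfSurjective Ideal.Quotient.mk_surjective,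
    fun y hy => Subtype.ext (hh ⟨y, hy⟩)⟩

lemma exists_injective_exact (A : Type u) [AddCommGroup A] [Module S A] :
    ∃ (E : Type u) (_ : AddCommGroup E) (_ : Module S E) (f : A →ₗ[S] E),
      Module.Injective S E ∧ Function.Injective f := by
  obtain ⟨⟨E, hE, f, hf⟩⟩ := EnoughInjectives.presentation (ModuleCat.of S A)
  exact ⟨E, inferInstance, inferInstance, f.hom,
    @Module.injective_module_of_injective_object S E _ _ _ hE,
    (ModuleCat.mono_iff_injective _).1 hf⟩

/-- Taking `x`-torsion is exact on `x`-divisible modules and preserves injectivity. Injectives and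
their quotients are `x`-divisible, so the induction stays within this class. -/
lemma hasInjectiveDimensionLE_torsionBy (hx : x ∈ nonZeroDivisors S) (d : ℕ) (A : Type u)
    [AddCommGroup A] [Module S A] (hA : Function.Surjective fun a : A => x • a)
    (hd : HasInjectiveDimensionLE (ModuleCat.of S A) d) :
    HasInjectiveDimensionLE (ModuleCat.of (S ⧸ Ideal.span {x}) (Submodule.torsionBy S A x)) d := by
  induction d generalizing A with
  | zero =>
    rw [HasInjectiveDimensionLE, zero_add, ← injective_iff_hasInjectiveDimensionLT_one,
      ← Module.injective_iff_injective_object] at hd ⊢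
    exact hd.torsionBy x
  | succ d ih =>
    obtain ⟨E, _, _, f, hE, hf⟩ := exists_injective_exact (S := S) A
    have hex : Function.Exact f (LinearMap.range f).mkQ := LinearMap.exact_map_mkQ_range f
    have hsurj := (LinearMap.range f).mkQ_surjective
    have hET := hE.torsionBy x
    rw [Module.injective_iff_injective_object] at hE hET
    have hC := ((hex.shortComplex_shortExact hf hsurj).hasInjectiveDimensionLT_X₃_iff d hE).2 hd
    have hdiv : Function.Surjective fun c : E ⧸ LinearMap.range f => x • c := by
      intro c
      obtain ⟨e, rfl⟩ := hsurj c
      obtain ⟨e, rfl⟩ := ((Module.injective_iff_injective_object S E).2 hE).smul_surjective hx e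
      exact ⟨Submodule.mkQ _ e, (map_smul _ _ _).symm⟩
    exact (((torsionByMap_exact x hf hex).shortComplex_shortExact (torsionByMap_injective x hf)
      (torsionByMap_surjective x hex hsurj hA)).hasInjectiveDimensionLT_X₃_iff d hET).1
        (ih _ hdiv hC)

/-- The connecting map `(E/S)[x] → S/(x)` of the snake lemma for multiplication by `x` on
`0 → S → E → E/S → 0`. -/
lemma exists_torsionBy_connecting {A E : Type u} [AddCommGroup A] [Module S A] [AddCommGroup E]
    [Module S E] {f : S →ₗ[S] E} (hf : Function.Injective f) {g : E →ₗ[S] A} (hg : Function.Surjective g)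
    (hex : Function.Exact f g) (hE : Function.Surjective fun e : E => x • e) :
    ∃ δ : Submodule.torsionBy S A x →ₗ[S ⧸ Ideal.span {x}] S ⧸ Ideal.span {x},
      Function.Exact (torsionByMap x g) δ ∧ Function.Surjective δ := by
  -- `D` is the preimage in `E` of the `x`-torsion of `E/S`; the connecting map sends `e ∈ D` to `xe
  -- ∈ S` modulo `x`.
  let D : Submodule S E := (LinearMap.range f).comap (LinearMap.lsmul S E x)
  have hD (e : E) : e ∈ D ↔ g e ∈ Submodule.torsionBy S A x := by
    rw [Submodule.mem_torsionBy_iff, ← map_smul]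
    exact (hex (x • e)).symm
  let q : D →ₗ[S] Submodule.torsionBy S A x := g.restrict fun e he => (hD e).1 he
  have hq : Function.Surjective q := by
    rintro ⟨a, ha⟩
    obtain ⟨e, rfl⟩ := hg a
    exact ⟨⟨e, (hD e).2 ha⟩, rfl⟩
  let φ : S ≃ₗ[S] LinearMap.range f := LinearEquiv.ofInjective f hf
  let xD : D →ₗ[S] LinearMap.range f := (LinearMap.lsmul S E x).restrict fun e he => he
  let p : D →ₗ[S] S ⧸ Ideal.span {x} :=
    Submodule.mkQ (Ideal.span {x}) ∘ₗ φ.symm.toLinearMap ∘ₗ xD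
  have hp (e : D) (s : S) (hs : f s = x • (e : E)) : p e = Submodule.mkQ (Ideal.span {x}) s := by
    have : xD e = φ s := Subtype.ext hs.symm
    simp [p, this]
  have hker : LinearMap.ker q ≤ LinearMap.ker p := by
    intro e he
    obtain ⟨s, hs⟩ := (hex e).1 (congrArg Subtype.val he)
    rw [LinearMap.mem_ker, hp e (x * s) (by rw [← smul_eq_mul, map_smul, hs]),
      Submodule.mkQ_apply, Submodule.Quotient.mk_eq_zero]
    exact Ideal.mul_mem_right s _ (Ideal.mem_span_singleton_self x)
  let δ : Submodule.torsionBy S A x →ₗ[S] S ⧸ Ideal.span {x} :=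
    Submodule.liftQ _ p hker ∘ₗ (q.quotKerEquivOfSurjective hq).symm.toLinearMap
  have hδ (e : D) : δ (q e) = p e := by
    have : q e = q.quotKerEquivOfSurjective hq (Submodule.Quotient.mk e) := rfl
    rw [LinearMap.comp_apply, LinearEquiv.coe_coe, this, LinearEquiv.symm_apply_apply,
      Submodule.liftQ_apply]
  refine ⟨δ.extendScalarsOfSurjective Ideal.Quotient.mk_surjective, fun a => ?_, fun y => ?_⟩
  · obtain ⟨e, rfl⟩ := hq a
    change δ (q e) = 0 ↔ _
    rw [hδ]
    constructor
    · intro h0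
      obtain ⟨s, hs⟩ : x • (e : E) ∈ LinearMap.range f := e.2
      rw [hp e s hs, Submodule.mkQ_apply, Submodule.Quotient.mk_eq_zero,
        Ideal.mem_span_singleton'] at h0
      obtain ⟨t, rfl⟩ := h0
      refine ⟨⟨e - f t, ?_⟩, Subtype.ext ?_⟩
      · rw [Submodule.mem_torsionBy_iff, smul_sub, ← hs, mul_comm, ← smul_eq_mul, map_smul, sub_self]
      · rw [coe_torsionByMap, map_sub, hex.apply_apply_eq_zero, sub_zero]
        rfl
    · rintro ⟨b, hb⟩
      have hbD : (b : E) ∈ D := (hD b).2 (torsionByMap x g b).2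
      have : q e = q ⟨b, hbD⟩ := hb.symm
      rw [← hδ, this, hδ, hp ⟨b, hbD⟩ 0 (by rw [map_zero, Submodule.smul_coe_torsionBy]), map_zero]
  · obtain ⟨s, rfl⟩ := Submodule.mkQ_surjective _ y
    obtain ⟨e, he⟩ := hE (f s)
    have heD : e ∈ D := ⟨s, he.symm⟩
    exact ⟨q ⟨e, heD⟩, (hδ _).trans (hp _ s he.symm)⟩

/-- For `S ⊆ E` with `E` injective, the snake lemma gives `0 → E[x] → (E/S)[x] → S/(x) → 0`, because
`S[x] = 0` and `E = xE`. The first term is injective and the second has injective dimension at most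
`d`. -/
lemma hasInjectiveDimensionLE_quotient_span_singleton {x : S} (hx : x ∈ nonZeroDivisors S) (d : ℕ)
    (hd : HasInjectiveDimensionLE (ModuleCat.of S S) (d + 1)) :
    HasInjectiveDimensionLE
      (ModuleCat.of (S ⧸ Ideal.span {x}) (S ⧸ Ideal.span {x})) d := by
  obtain ⟨E, _, _, f, hE, hf⟩ := exists_injective_exact (S := S) S
  have hex : Function.Exact f (LinearMap.range f).mkQ := LinearMap.exact_map_mkQ_range f
  have hsurj := (LinearMap.range f).mkQ_surjective
  have hET := hE.torsionBy x
  have hdivE := hE.smul_surjective hx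
  rw [Module.injective_iff_injective_object] at hE hET
  have hC := ((hex.shortComplex_shortExact hf hsurj).hasInjectiveDimensionLT_X₃_iff d hE).2 hd
  have hdiv : Function.Surjective fun c : E ⧸ LinearMap.range f => x • c := by
    intro c
    obtain ⟨e, rfl⟩ := hsurj c
    obtain ⟨e, rfl⟩ := hdivE e
    exact ⟨Submodule.mkQ _ e, (map_smul _ _ _).symm⟩
  obtain ⟨δ, hδ, hδs⟩ := exists_torsionBy_connecting x hf hsurj hex hdivE
  have hinj : Function.Injective (torsionByMap x (LinearMap.range f).mkQ) := by
    rw [injective_iff_map_eq_zero]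
    intro e he
    obtain ⟨s, hs⟩ := (hex e).1 (congrArg Subtype.val he)
    have h0 : x * s = x * 0 := by
      apply hf
      rw [← smul_eq_mul, map_smul, hs, Submodule.smul_coe_torsionBy, mul_zero, map_zero]
    rw [mul_cancel_left_mem_nonZeroDivisors hx] at h0
    apply Subtype.ext
    rw [← hs, h0, map_zero]
    rfl
  exact (hδ.shortComplex_shortExact hinj hδs).hasInjectiveDimensionLT_X₃ (d + 1)
    (hasInjectiveDimensionLE_torsionBy x hx d _ hdiv hC)
    (have := hET; hasInjectiveDimensionLT_of_ge
      (ModuleCat.of (S ⧸ Ideal.span {x}) (Submodule.torsionBy S E x)) 1 _ (by omega))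

lemma ker_comp_quotient_mk_le {S B : Type*} [CommRing S] [CommRing B] [IsLocalRing S]
    {J : Ideal S} [IsLocalRing (S ⧸ J)] {N : ℕ} (hJ : J ≤ IsLocalRing.maximalIdeal S ^ N)
    {φ : S ⧸ J →+* B} (hφ : RingHom.ker φ ≤ IsLocalRing.maximalIdeal (S ⧸ J) ^ N) :
    RingHom.ker (φ.comp (Ideal.Quotient.mk J)) ≤ IsLocalRing.maximalIdeal S ^ N := by
  intro s hs
  have hmax : IsLocalRing.maximalIdeal (S ⧸ J) ≤
      (IsLocalRing.maximalIdeal S).map (Ideal.Quotient.mk J) := by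
    intro z hz
    obtain ⟨t, rfl⟩ := Ideal.Quotient.mk_surjective z
    exact Ideal.mem_map_of_mem _ fun ht => hz (ht.map _)
  have hs' : Ideal.Quotient.mk J s ∈ (IsLocalRing.maximalIdeal S ^ N).map (Ideal.Quotient.mk J) := by
    rw [Ideal.map_pow]
    exact Ideal.pow_right_mono hmax N (hφ hs)
  rwa [Ideal.mem_quotient_iff_mem_sup, sup_eq_left.2 hJ] at hs'

/-- A Noetherian local ring of finite injective dimension has self-injective quotients by ideals
contained in arbitrarily high powers of the maximal ideal. -/
lemma exists_selfInjective_quotient (d : ℕ) : ∀ (S : Type u) [CommRing S] [IsNoetherianRing S]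
    [IsLocalRing S] (_ : HasInjectiveDimensionLE (ModuleCat.of S S) d) (N : ℕ),
    ∃ (B : Type u) (_ : CommRing B) (φ : S →+* B), Function.Surjective φ ∧
      RingHom.ker φ ≤ IsLocalRing.maximalIdeal S ^ N ∧ Module.Injective B B := by
  induction d with
  | zero =>
    intro S _ _ _ hd N
    rw [HasInjectiveDimensionLE, zero_add, ← injective_iff_hasInjectiveDimensionLT_one,
      ← Module.injective_iff_injective_object] at hd
    exact ⟨S, inferInstance, RingHom.id S, Function.surjective_id,
      fun s hs => (show s = 0 from hs) ▸ zero_mem _, hd⟩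
  | succ d ih =>
    intro S _ _ _ hd N
    by_cases h : Disjoint (IsLocalRing.maximalIdeal S : Set S) (nonZeroDivisors S)
    · exact ⟨S, inferInstance, RingHom.id S, Function.surjective_id,
        fun s hs => (show s = 0 from hs) ▸ zero_mem _,
        injective_self_of_disjoint_nonZeroDivisors h _ hd⟩
    · obtain ⟨x, hxm, hx⟩ := Set.not_disjoint_iff.1 h
      -- The exponent `N + 1` puts the power in the `N`-th power of the maximal ideal and keeps it a
      -- nonunit even for `N = 0`.
      have hy : x ^ (N + 1) ∈ nonZeroDivisors S := pow_mem hx _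
      have hym : x ^ (N + 1) ∈ IsLocalRing.maximalIdeal S :=
        Ideal.pow_mem_of_mem _ hxm _ N.succ_pos
      have : Nontrivial (S ⧸ Ideal.span {x ^ (N + 1)}) := by
        refine Ideal.Quotient.nontrivial_iff.2 fun htop => ?_
        exact (IsLocalRing.maximalIdeal.isMaximal S).ne_top
          (top_le_iff.1 (htop ▸ (Ideal.span_singleton_le_iff_mem _).2 hym))
      have : IsLocalRing (S ⧸ Ideal.span {x ^ (N + 1)}) :=
        .of_surjective' (Ideal.Quotient.mk _) Ideal.Quotient.mk_surjective
      obtain ⟨B, _, φ, hφ, hker, hB⟩ := ih (S ⧸ Ideal.span {x ^ (N + 1)})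
        (hasInjectiveDimensionLE_quotient_span_singleton hy d hd) N
      exact ⟨B, inferInstance, φ.comp (Ideal.Quotient.mk _), hφ.comp Ideal.Quotient.mk_surjective,
        ker_comp_quotient_mk_le ((Ideal.span_singleton_le_iff_mem _).2
          (Ideal.pow_le_pow_right N.le_succ (Ideal.pow_mem_pow hxm _))) hker, hB⟩

end

/-! ### From local to global, and the approximately Gorenstein case -/

/-- If `x ∉ L`, let `p` be a maximal ideal containing `(L : x)`. Krull's intersection theorem in
`M/L` gives `r ∈ p` with `(1 - r)x ∈ L`, so `1 - r ∈ p`, a contradiction. -/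
lemma mem_of_forall_mem_sup_pow_smul {T M : Type*} [CommRing T] [IsNoetherianRing T]
    [AddCommGroup M] [Module T M] [Module.Finite T M] {L : Submodule T M} {x : M}
    (h : ∀ p : Ideal T, p.IsMaximal → ∀ N : ℕ, x ∈ L ⊔ (p ^ N • ⊤ : Submodule T M)) : x ∈ L := by
  by_contra hx
  have hne : L.colon {x} ≠ ⊤ := fun htop => hx <| by
    have h1 : (1 : T) ∈ L.colon {x} := htop ▸ trivial
    rwa [Submodule.mem_colon_singleton, one_smul] at h1
  obtain ⟨p, hp, hle⟩ := Ideal.exists_le_maximal _ hne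
  have hmem : L.mkQ x ∈ (⨅ N : ℕ, p ^ N • ⊤ : Submodule T (M ⧸ L)) := by
    rw [Submodule.mem_iInf]
    intro N
    obtain ⟨a, ha, b, hb, rfl⟩ := Submodule.mem_sup.1 (h p hp N)
    have : L.mkQ (a + b) = L.mkQ b := by
      rw [map_add, show L.mkQ a = 0 from (Submodule.Quotient.mk_eq_zero L).2 ha, zero_add]
    rw [this]
    have hb' := Submodule.mem_map_of_mem (f := L.mkQ) hb
    rw [Submodule.map_smul''] at hb'
    exact Submodule.smul_mono le_rfl le_top hb'
  obtain ⟨⟨r, hr⟩, hrx⟩ := (Ideal.mem_iInf_smul_pow_eq_bot_iff p _).1 hmem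
  have h1 : 1 - r ∈ p := by
    refine hle (Submodule.mem_colon_singleton.2 ?_)
    rw [← Submodule.Quotient.mk_eq_zero L, Submodule.Quotient.mk_smul, sub_smul, one_smul,
      sub_eq_zero]
    exact hrx.symm
  exact hp.ne_top ((Ideal.eq_top_iff_one p).2 (by simpa using p.add_mem h1 hr))

lemma exists_common_multiplier {T : Type*} [CommRing T] {p : Ideal T} [hp : p.IsPrime] {ι : Type*}
    [Finite ι] {P : ι → T → Prop} (hP : ∀ i s c, P i s → P i (s * c))
    (h : ∀ i, ∃ s ∉ p, P i s) : ∃ s ∉ p, ∀ i, P i s := by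
  have := Fintype.ofFinite ι
  choose s hs hPs using h
  refine ⟨∏ i, s i, Submonoid.prod_mem p.primeCompl fun i _ => hs i, fun i => ?_⟩
  obtain ⟨c, hc⟩ := Finset.dvd_prod_of_mem s (Finset.mem_univ i)
  rw [hc]
  exact hP i _ c (hPs i)

namespace WeakLifting

section

variable {T : Type u} [CommRing T]

/-- If `B` is a self-injective ring obtained from a quotient of `T/I` by localizing at `p`, then,
up to a factor outside `p`, the zeroth row of `X` becomes over `B` a combination of the others. -/
lemma exists_row_relation {f : T} {I : Ideal T} {n m : ℕ} {fs : Fin n → T}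
    (hfs : ∀ i, fs i ∈ I) {X : Matrix (Fin (n + 1)) (Fin m) T}
    (hX : IsPresentation (Fin.cons f fs : Fin (n + 1) → T) X) {B : Type u} [CommRing B]
    (hB : Module.Injective B B) (ρ : T →+* B)
    (hcolon : (I * RingHom.ker ρ).colon {f} ≤ RingHom.ker ρ)
    {p : Ideal T} [p.IsPrime] (hunit : ∀ s ∉ p, IsUnit (ρ s))
    (hfrac : ∀ b : B, ∃ s ∉ p, ∃ t, ρ s * b = ρ t) :
    ∃ s ∉ p, ∃ t : Fin n → T, ∀ j, s * X 0 j - ∑ i, t i * X i.succ j ∈ RingHom.ker ρ := by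
  have hfrac' {k : ℕ} (z : Fin k → B) : ∃ s ∉ p, ∃ t : Fin k → T, ∀ j, ρ s * z j = ρ (t j) := by
    obtain ⟨s, hs, h⟩ := exists_common_multiplier (p := p)
      (P := fun j s => ∃ t, ρ s * z j = ρ t) (fun j s c ⟨t, ht⟩ => ⟨t * c, by
        rw [map_mul, mul_right_comm, ht, map_mul]⟩) fun j => hfrac (z j)
    choose t ht using h
    exact ⟨s, hs, t, ht⟩
  let e : (Fin m → B) →ₗ[B] (Fin n → B) :=
    (Matrix.of fun (i : Fin n) (j : Fin m) => ρ (X i.succ j)).mulVecLin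
  let r : (Fin m → B) →ₗ[B] B := Fintype.linearCombination B fun j => ρ (X 0 j)
  have he (z : Fin m → B) (i : Fin n) : e z i = ∑ j, ρ (X i.succ j) * z j := rfl
  have hr (z : Fin m → B) : r z = ∑ j, z j * ρ (X 0 j) := rfl
  -- After clearing denominators, `z` comes from `t ∈ T^m`. All entries of `Xt` but the zeroth lie
  -- in `ker ρ`, and `Xt` is a relation on the generators, so `(Xt)_0 · f ∈ I · ker ρ` and the colon
  -- hypothesis applies.
  have hker : LinearMap.ker e ≤ LinearMap.ker r := by
    intro z hz
    obtain ⟨s, hs, t, ht⟩ := hfrac' z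
    have hw (i : Fin (n + 1)) : ρ (X.mulVec t i) = ρ s * ∑ j, ρ (X i j) * z j := by
      simp only [Matrix.mulVec, dotProduct, map_sum, map_mul, ← ht, Finset.mul_sum]
      exact Finset.sum_congr rfl fun j _ => by ring
    have hws (i : Fin n) : X.mulVec t i.succ ∈ RingHom.ker ρ := by
      rw [RingHom.mem_ker, hw, ← he, LinearMap.mem_ker.1 hz, Pi.zero_apply, mul_zero]
    have hsum : X.mulVec t 0 * f + ∑ i : Fin n, X.mulVec t i.succ * fs i = 0 := by
      have := (hX (X.mulVecLin t)).2 ⟨t, rfl⟩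
      simpa [Fintype.linearCombination_apply, Fin.sum_univ_succ] using this
    have h0 : X.mulVec t 0 ∈ RingHom.ker ρ := by
      refine hcolon (Submodule.mem_colon_singleton.2 ?_)
      rw [smul_eq_mul, eq_neg_of_add_eq_zero_left hsum]
      exact neg_mem (Ideal.sum_mem _ fun i _ => 
        Ideal.mul_mem_mul_rev (hfs i) (hws i))
    rw [RingHom.mem_ker, hw, (hunit s hs).mul_right_eq_zero] at h0
    rw [LinearMap.mem_ker, hr, ← h0]
    exact Finset.sum_congr rfl fun j _ => mul_comm _ _
  -- `r` factors through the image of `e`; self-injectivity extends it to `B^n`, and the values on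
  -- the basis are the coefficients sought.
  obtain ⟨h, hh⟩ := hB.out ((LinearMap.ker e).liftQ e le_rfl)
    (LinearMap.ker_eq_bot.1 (Submodule.ker_liftQ_eq_bot _ _ _ le_rfl))
    ((LinearMap.ker e).liftQ r hker)
  have hcol (j : Fin m) : ρ (X 0 j) = ∑ i, ρ (X i.succ j) * h (Pi.single i 1) := by
    have h1 := hh (Submodule.Quotient.mk (Pi.single j 1))
    rw [Submodule.liftQ_apply, Submodule.liftQ_apply] at h1
    have hrj : r (Pi.single j 1) = ρ (X 0 j) := by
      simp [r]
    have hej : e (Pi.single j 1) = fun i => ρ (X i.succ j) := by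
      ext i
      simp [he, Pi.single_apply]
    rw [← hrj, ← h1, hej, LinearMap.pi_apply_eq_sum_univ h]
    refine Finset.sum_congr rfl fun i _ => ?_
    rw [smul_eq_mul]
    congr 2
    ext k
    simp [Pi.single_apply, eq_comm]
  obtain ⟨s, hs, t, ht⟩ := hfrac' fun i => h (Pi.single i 1)
  refine ⟨s, hs, t, fun j => ?_⟩
  rw [RingHom.mem_ker, map_sub, map_mul, hcol, map_sum, Finset.mul_sum, sub_eq_zero]
  refine Finset.sum_congr rfl fun i _ => ?_
  rw [map_mul, ← ht]
  ring

lemma IsApproxGorensteinLocal.exists_selfInjective {A : Type u} [CommRing A] [IsLocalRing A]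
    (hA : IsApproxGorensteinLocal A) (N : ℕ) :
    ∃ (B : Type u) (_ : CommRing B) (φ : A →+* B), Function.Surjective φ ∧
      RingHom.ker φ ≤ IsLocalRing.maximalIdeal A ^ N ∧ Module.Injective B B := by
  obtain ⟨Q, hQ, _, _, d, hd⟩ := hA N
  obtain ⟨B, _, φ, hφ, hker, hB⟩ := exists_selfInjective_quotient d (A ⧸ Q) hd N
  exact ⟨B, inferInstance, φ.comp (Ideal.Quotient.mk Q), hφ.comp Ideal.Quotient.mk_surjective,
    ker_comp_quotient_mk_le hQ hker, hB⟩

/-- The self-injective test rings for `T/I` approximately Gorenstein. -/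
lemma IsApproxGorenstein.exists_selfInjective {I : Ideal T} (hA : IsApproxGorenstein (T ⧸ I))
    {p : Ideal T} (hp : p.IsMaximal) (hIp : I ≤ p) (N : ℕ) :
    ∃ (B : Type u) (_ : CommRing B) (ρ : T →+* B), Module.Injective B B ∧ I ≤ RingHom.ker ρ ∧
      (∀ s ∉ p, IsUnit (ρ s)) ∧ (∀ b : B, ∃ s ∉ p, ∃ t, ρ s * b = ρ t) ∧
      ∀ t ∈ RingHom.ker ρ, ∃ s ∉ p, s * t ∈ p ^ N ⊔ I := by
  let q : Ideal (T ⧸ I) := p.map (Ideal.Quotient.mk I)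
  have hmem (t : T) : Ideal.Quotient.mk I t ∈ q ↔ t ∈ p := by
    rw [Ideal.mem_quotient_iff_mem_sup, sup_eq_left.2 hIp]
  have hq : q.IsMaximal := by
    refine (Ideal.map_eq_top_or_isMaximal_of_surjective _
      Ideal.Quotient.mk_surjective hp).resolve_left fun htop => hp.ne_top ((Ideal.eq_top_iff_one p).2 ((hmem 1).1
        (by rw [show q = ⊤ from htop]; trivial)))
  obtain ⟨B, _, ψ, hψ, hker, hB⟩ := (hA.2 q).exists_selfInjective N
  let loc := algebraMap (T ⧸ I) (Localization.AtPrime q)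
  refine ⟨B, inferInstance, (ψ.comp loc).comp (Ideal.Quotient.mk I), hB, fun t ht => ?_,
    fun s hs => ?_, fun b => ?_, fun t ht => ?_⟩
  · rw [RingHom.mem_ker, RingHom.comp_apply, Ideal.Quotient.eq_zero_iff_mem.2 ht, map_zero]
  · exact (IsLocalization.map_units (Localization.AtPrime q)
      (⟨Ideal.Quotient.mk I s, fun h => hs ((hmem s).1 h)⟩ : q.primeCompl)).map ψ
  · obtain ⟨b, rfl⟩ := hψ b
    obtain ⟨⟨a, ⟨s, hs⟩⟩, h⟩ := IsLocalization.surj q.primeCompl b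
    obtain ⟨a, rfl⟩ := Ideal.Quotient.mk_surjective a
    obtain ⟨s, rfl⟩ := Ideal.Quotient.mk_surjective s
    refine ⟨s, fun h => hs ((hmem s).2 h), a, ?_⟩
    rw [mul_comm]
    exact (map_mul ψ _ _).symm.trans (congrArg ψ h)
  · have ht' : loc (Ideal.Quotient.mk I t) ∈ IsLocalRing.maximalIdeal (Localization.AtPrime q) ^ N :=
      hker ht
    rw [← Localization.AtPrime.map_eq_maximalIdeal, ← Ideal.map_pow,
      IsLocalization.algebraMap_mem_map_algebraMap_iff q.primeCompl] at ht'
    obtain ⟨s, hs, h⟩ := ht'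
    obtain ⟨s, rfl⟩ := Ideal.Quotient.mk_surjective s
    refine ⟨s, fun h => hs ((hmem s).2 h), ?_⟩
    rwa [← map_mul, ← Ideal.map_pow, Ideal.mem_quotient_iff_mem_sup] at h

lemma rowCondition_of_isApproxGorenstein [IsNoetherianRing T] {f : T} {I : Ideal T}
    {n m : ℕ} {fs : Fin n → T} (hfs : ∀ i, fs i ∈ I) {X : Matrix (Fin (n + 1)) (Fin m) T}
    (hX : IsPresentation (Fin.cons f fs : Fin (n + 1) → T) X)
    (hA : IsApproxGorenstein (T ⧸ I)) (h : ∀ J : Ideal T, I ≤ J → (I * J).colon {f} ≤ J) :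
    RowCondition I X := by
  let R : Submodule T (Fin m → T) := Submodule.span T (Set.range fun i : Fin n => X i.succ)
  have key : X 0 ∈ R ⊔ (I • ⊤ : Submodule T (Fin m → T)) := by
    refine mem_of_forall_mem_sup_pow_smul fun p hp N => ?_
    rw [sup_assoc, ← Submodule.sup_smul, sup_comm I]
    by_cases hIp : I ≤ p
    · obtain ⟨B, _, ρ, hB, hIρ, hunit, hfrac, hker⟩ := hA.exists_selfInjective hp hIp N
      obtain ⟨s, hs, t, hst⟩ :=
        exists_row_relation hfs hX hB ρ (h _ hIρ) hunit hfrac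
      obtain ⟨s', hs', hst'⟩ := exists_common_multiplier (p := p)
        (P := fun j s' => s' * (s * X 0 j - ∑ i, t i * X i.succ j) ∈ p ^ N ⊔ I)
        (fun j s' c h => by
          rw [mul_right_comm]
          exact Ideal.mul_mem_right c _ h) fun j => hker _ (hst j)
      have hmem : (s' * s) • X 0 ∈ R ⊔ ((p ^ N ⊔ I) • ⊤ : Submodule T (Fin m → T)) := by
        have hz : s' • (s • X 0 - ∑ i, t i • X i.succ) ∈
            ((p ^ N ⊔ I) • ⊤ : Submodule T (Fin m → T)) :=
          mem_ideal_smul_top_pi_iff.2 fun j => by simpa [Finset.sum_apply] using hst' j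
        have hR : s' • ∑ i, t i • X i.succ ∈ R :=
          R.smul_mem _ (R.sum_mem fun i _ => R.smul_mem _ (Submodule.subset_span ⟨i, rfl⟩))
        have := add_mem (show _ ∈ R ⊔ _ from Submodule.mem_sup_right hz) (Submodule.mem_sup_left hR)
        rwa [smul_sub, sub_add_cancel, smul_smul] at this
      have hss : s' * s ∉ p := fun h => (hp.isPrime.mem_or_mem h).elim hs' hs
      -- The multiplier `s' * s` lies outside the maximal ideal `p`, so it is a unit modulo `p ^ N`
      -- and can be cancelled.
      have hcop : Ideal.span {s' * s} ⊔ p ^ N = ⊤ := by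
        refine Ideal.sup_pow_eq_top ?_
        rw [sup_comm]
        exact hp.1.2 _ (left_lt_sup.2 fun h => hss (h (Ideal.mem_span_singleton_self _)))
      obtain ⟨a, ha, b, hb, hab⟩ := Submodule.mem_sup.1 ((Ideal.eq_top_iff_one _).1 hcop)
      obtain ⟨c, rfl⟩ := Ideal.mem_span_singleton'.1 ha
      rw [← one_smul T (X 0), ← hab, add_smul, mul_smul]
      exact add_mem (Submodule.smul_mem _ c hmem)
        (Submodule.mem_sup_right (Submodule.smul_mem_smul (Ideal.mem_sup_left hb) trivial))
    · have hcop : p ^ N ⊔ I = ⊤ := by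
        rw [sup_comm]
        exact Ideal.sup_pow_eq_top (by
          rw [sup_comm]; exact hp.1.2 _ (left_lt_sup.2 hIp))
      rw [hcop, Submodule.top_smul, sup_top_eq]
      trivial
  obtain ⟨y, hy, z, hz, hyz⟩ := Submodule.mem_sup.1 key
  obtain ⟨x, rfl⟩ := (Submodule.mem_span_range_iff_exists_fun T).1 hy
  exact ⟨x, by rwa [← hyz, add_sub_cancel_left]⟩

end

end WeakLifting

theorem lemma4p2 {T : Type u} [CommRing T] [IsNoetherianRing T]
    (f : T) (hf : f ∈ nonZeroDivisors T) (I : Ideal T) (hfI : f ∈ I)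
    (n : ℕ) (fs : Fin n → T)
    (hI : Ideal.span (Set.range (Fin.cons f fs : Fin (n + 1) → T)) = I) :
    -- conditions (1), (2), (3), (4) (for every presentation, and for some presentation)
    List.TFAE [
      WeakLifting.QuotientWeaklyLiftable I f hfI,
      WeakLifting.Splits (WeakLifting.mapToModF I f hfI),
      WeakLifting.Splits (WeakLifting.mapToCotangent I f hfI),
      ∀ (m : ℕ) (X : Matrix (Fin (n + 1)) (Fin m) T),
        WeakLifting.IsPresentation (Fin.cons f fs : Fin (n + 1) → T) X →
          WeakLifting.RowCondition I X,
      ∃ (m : ℕ) (X : Matrix (Fin (n + 1)) (Fin m) T),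
        WeakLifting.IsPresentation (Fin.cons f fs : Fin (n + 1) → T) X ∧
          WeakLifting.RowCondition I X] ∧
    -- they imply (5)
    (WeakLifting.QuotientWeaklyLiftable I f hfI →
      ∀ J : Ideal T, (I * J).colon {f} ≤ J ⊔ I) ∧
    -- (5) and (6) are equivalent
    ((∀ J : Ideal T, (I * J).colon {f} ≤ J ⊔ I) ↔
      ∀ J : Ideal T, I ≤ J → (I * J).colon {f} ≤ J) ∧
    -- in the local case they are also equivalent to (7)
    (IsLocalRing T →
      ((∀ J : Ideal T, I ≤ J → (I * J).colon {f} ≤ J) ↔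
        ∀ J : Ideal T, InfIrred J → I ≤ J → (I * J).colon {f} ≤ J)) ∧
    -- all the conditions are equivalent if `T/I` is approximately Gorenstein
    (WeakLifting.IsApproxGorenstein (T ⧸ I) →
      (WeakLifting.QuotientWeaklyLiftable I f hfI ↔
        ∀ J : Ideal T, (I * J).colon {f} ≤ J ⊔ I)) := by
  have hfs (i : Fin n) : fs i ∈ I := hI ▸ Ideal.subset_span ⟨i.succ, Fin.cons_succ _ _ _⟩
  have h1 := WeakLifting.quotientWeaklyLiftable_iff hf hfI
  have h5 : WeakLifting.QuotientWeaklyLiftable I f hfI →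
      ∀ J : Ideal T, (I * J).colon {f} ≤ J ⊔ I := fun h => by
    obtain ⟨φ, hφ⟩ := h1.1 h
    exact WeakLifting.colon_le_sup_of_linearMap hφ
  -- One presentation must exist, both for (4) ⇒ (4′) and to test the row condition in the
  -- approximately Gorenstein case.
  obtain ⟨m, X, hX⟩ := WeakLifting.IsPresentation.exists_of_isNoetherianRing
    (Fin.cons f fs : Fin (n + 1) → T)
  refine ⟨?_, h5, WeakLifting.forall_colon_le_sup_iff I f,
    fun _ => WeakLifting.forall_colon_le_iff_forall_infIrred I f, fun hA => ⟨h5, fun h => ?_⟩⟩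
  · tfae_have 1 ↔ 2 := h1.trans (WeakLifting.splits_mapToModF_iff hfI).symm
    tfae_have 1 ↔ 3 := h1.trans (WeakLifting.splits_mapToCotangent_iff hfI).symm
    tfae_have 1 → 4 := fun h m X hX => by
      obtain ⟨φ, hφ⟩ := h1.1 h
      exact WeakLifting.rowCondition_of_linearMap hfI hfs hX hφ
    tfae_have 4 → 5 := fun h => ⟨m, X, hX, h m X hX⟩
    tfae_have 5 → 1 := fun ⟨_, _, hX, h⟩ =>
      h1.2 (WeakLifting.linearMap_of_rowCondition hfI hI hX h)
    tfae_finish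
  · exact h1.2 (WeakLifting.linearMap_of_rowCondition hfI hI hX
      (WeakLifting.rowCondition_of_isApproxGorenstein hfs hX hA
        ((WeakLifting.forall_colon_le_sup_iff I f).1 h)))
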